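/- Let $G=(V,E)$ be a finite, simple, undirected, connected graph with weights $\omega_{ij}=\omega_{ji}\ge 0$, where $\omega_{ij}>0$ if and only if $ij\in E$ (so $\omega_{ii}=0$). Fix $r\in[0,1]$ and $\varepsilon>0$, and put $d_i:=\sum_{j}\omega_{ij}$. For $u,v:V\to\mathbb{R}$ let $$\langle u,v\rangle_{\mathcal V}:=\sum_{i\in V}u_iv_id_i^{\,r},\qquad \|u\|_{\mathcal V}:=\sqrt{\langle u,u\rangle_{\mathcal V}},\qquad (\Delta u)_i:=d_i^{-r}\sum_{j\in V}\omega_{ij}(u_i-u_j),\qquad \|\nabla u\|_{\mathcal E}^2:=\tfrac12\sum_{i,j\in V}\omega_{ij}(u_j-u_i)^2$$ (for the one-vertex graph with $r>0$, read $0^{\pm r}:=0$). Let $\mu:V\to[0,\infty)$ with $\mu\neq\mathbf 0$, let $\tilde f:V\to[0,1]$, and put $M:=\operatorname{diag}(\mu)$, $A:=\Delta+M$, $f:=M\tilde f$. Let $W(x):=\frac12x(1-x)$ for $x\in[0,1]$ and $W(x):=\infty$ otherwise, and $$\mathrm{GL}_{\mathrm{fid}}(u):=\tfrac12\|\nabla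 u\|_{\mathcal E}^2+\tfrac1\varepsilon\sum_{i\in V}W(u_i)\,d_i^{\,r}+\tfrac12\langle u-\tilde f,M(u-\tilde f)\rangle_{\mathcal V}.$$ Let $T=[0,\infty)$ or $T=[0,T_0]$ with $T_0>0$. Let $(u,\beta)$ be a solution on $T$ of the double-obstacle Allen–Cahn equation with fidelity forcing. That is, $u:T\to[0,1]^V$ is continuous and belongs to $H^1_{\mathrm{loc}}(T;\mathbb{R}^V)$, meaning that $u\in H^1((a,b);\mathbb{R}^V)$ for all $a,b\in T$; also $\beta:T\to\mathbb{R}^V$, and for almost every $t\in T$, with $\frac{du}{dt}$ the weak derivative, $$\varepsilon\frac{du}{dt}(t)+\varepsilon Au(t)-\varepsilon f+\tfrac12\mathbf 1-u(t)=\beta(t),\qquad \beta_i(t)\in-\partial I_{[0,1]}(u_i(t))\ \text{ for all } i\in V.$$ Here $\partial I_{[0,1]}$ is the subdifferential of the function equal to $0$ on $[0,1]$ and $\infty$ elsewhere; thus $\beta_i(t)\ge0$ if $u_i(t)=0$, $\beta_i(t)=0$ if $0<u_i(t)<1$, and $\beta_i(t)\le 0$ if $u_i(t)=1$. Suppose that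 $\varepsilon^{-1}$ is not an eigenvalue of $A$. Then $t\mapsto\mathrm{GL}_{\mathrm{fid}}(u(t))$ is finite and nonincreasing on $T$. More precisely, for all $s,t\in T$ with $s<t$, $$\mathrm{GL}_{\mathrm{fid}}(u(s))-\mathrm{GL}_{\mathrm{fid}}(u(t))\ \ge\ \frac{1}{2(t-s)}\,\|u(s)-u(t)\|_{\mathcal V}^2 .$$ Furthermore, for all $s,t\in T$, $$\|u(s)-u(t)\|_{\mathcal V}\le\sqrt{|t-s|}\,\sqrt{2\,\mathrm{GL}_{\mathrm{fid}}(u(0))}.$$ -/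

import Mathlib

namespace GraphACE

open MeasureTheory Set

open scoped ContDiff

noncomputable section

/-- A weighted graph: a simple, undirected, connected graph on `V` with symmetric nonnegative
weights `w i j` that are positive exactly on the edges (in particular `w i i = 0`). -/
structure WeightedGraph (V : Type*) extends SimpleGraph V where
  w : V → V → ℝ
  w_nonneg : ∀ i j, 0 ≤ w i j
  w_symm : ∀ i j, w i j = w j i
  w_pos_iff : ∀ i j, 0 < w i j ↔ Adj i j
  connected : toSimpleGraph.Connected

/-- The set of all `u : V → ℝ` with values in `X`. -/
def vertexFun (V : Type*) (X : Set ℝ) : Set (V → ℝ) := {u | ∀ i, u i ∈ X}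

section Graph

variable {V : Type*} [Fintype V] (G : WeightedGraph V)

/-- The degree `d i = ∑ j, w i j`. -/
def deg (i : V) : ℝ := ∑ j, G.w i j

/-- The inner product on vertex functions, `⟨u, v⟩ = ∑ i, u i * v i * (d i) ^ r`. -/
def vInner (r : ℝ) (u v : V → ℝ) : ℝ := ∑ i, u i * v i * deg G i ^ r

/-- The norm induced by `vInner`. -/
def vNorm (r : ℝ) (u : V → ℝ) : ℝ := Real.sqrt (vInner G r u u)

/-- The inner product on edge functions. Edge functions are written as functions of two vertices;
the weight is zero off the edges. -/
def eInner (p q : V → V → ℝ) : ℝ := (1 / 2) * ∑ i, ∑ j, p i j * q i j * G.w i j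

open Classical in
/-- The graph gradient. -/
def grad (u : V → ℝ) (i j : V) : ℝ := if G.Adj i j then u j - u i else 0

/-- The graph Laplacian `(Δ u) i = (d i) ^ (-r) * ∑ j, w i j * (u i - u j)`. -/
def lap (r : ℝ) : (V → ℝ) →ₗ[ℝ] (V → ℝ) where
  toFun u i := deg G i ^ (-r) * ∑ j, G.w i j * (u i - u j)
  map_add' u v := by
    funext i
    simp only [Pi.add_apply, ← mul_add, ← Finset.sum_add_distrib]
    congr 1
    exact Finset.sum_congr rfl fun j _ => by ring
  map_smul' c u := by
    funext i
    simp only [Pi.smul_apply, smul_eq_mul, RingHom.id_apply, Finset.mul_sum]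
    exact Finset.sum_congr rfl fun j _ => by ring

/-- The operator `M = diag(μ)`, that is `(M u) i = μ i * u i`. -/
def fidOp {V : Type*} (μ : V → ℝ) : (V → ℝ) →ₗ[ℝ] (V → ℝ) where
  toFun u i := μ i * u i
  map_add' u v := by
    funext i
    simp [mul_add]
  map_smul' c u := by
    funext i
    simp [mul_left_comm]

/-- The operator `A = Δ + M`. -/
def opA (r : ℝ) (μ : V → ℝ) : (V → ℝ) →ₗ[ℝ] (V → ℝ) := lap G r + fidOp μ

end Graph

/-- `σ(F)`, the set of eigenvalues of `F`. -/
def eigenvalueSet {V : Type*} (F : (V → ℝ) →ₗ[ℝ] (V → ℝ)) : Set ℝ :=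
  {l | Module.End.HasEigenvalue F l}

/-! ### The double-obstacle potential and the Ginzburg-Landau energy -/

open Classical in
/-- The double-obstacle potential: `x (1 - x) / 2` on `[0,1]` and `∞` elsewhere. -/
def obstacleW (x : ℝ) : EReal :=
  if x ∈ Icc (0 : ℝ) 1 then ((1 / 2 * x * (1 - x) : ℝ) : EReal) else ⊤

/-- The Ginzburg-Landau energy with fidelity,
`‖∇u‖² / 2 + ⟨W ∘ u, 1⟩ / ε + ⟨u - f', M (u - f')⟩ / 2`, with values in `(-∞, ∞]`; here `f'` is
the reference. The middle inner product is the sum defining `vInner`, taken in `EReal`. -/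
def energyFid {V : Type*} [Fintype V] (G : WeightedGraph V) (r ε : ℝ) (μ f' : V → ℝ)
    (u : V → ℝ) : EReal :=
  ((1 / 2 * eInner G (grad G u) (grad G u) : ℝ) : EReal)
    + ((1 / ε : ℝ) : EReal) * ∑ i, obstacleW (u i) * ((deg G i ^ r : ℝ) : EReal)
    + ((1 / 2 * vInner G r (u - f') (fidOp μ (u - f')) : ℝ) : EReal)

/-! ### The subdifferential of the obstacle -/

open Classical in
/-- The convex indicator function of `[0,1]`. -/
def indic01 (x : ℝ) : EReal := if x ∈ Icc (0 : ℝ) 1 then 0 else ⊤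

/-- The subdifferential at `x` of an extended-real valued function `g` on the line. -/
def subdiff (g : ℝ → EReal) (x : ℝ) : Set ℝ :=
  {p | g x ≠ ⊤ ∧ ∀ y : ℝ, g x + ((p * (y - x) : ℝ) : EReal) ≤ g y}

/-- The set `𝓑(u)` of all `α` with `α i ∈ -∂I(u i)` at each vertex, `I` the indicator of `[0,1]`. -/
def obstacleB {V : Type*} (u : V → ℝ) : Set (V → ℝ) :=
  {α | ∀ i, -(α i) ∈ subdiff indic01 (u i)}

/-- The explicit form of `𝓑(u)`. -/
theorem mem_obstacleB_iff {V : Type*} (u α : V → ℝ) :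
    α ∈ obstacleB u ↔ ∀ i, u i ∈ Icc (0 : ℝ) 1 ∧ (u i = 0 → 0 ≤ α i) ∧
      (0 < u i ∧ u i < 1 → α i = 0) ∧ (u i = 1 → α i ≤ 0) := by
  have key : ∀ x p : ℝ, -p ∈ subdiff indic01 x ↔
      x ∈ Icc (0 : ℝ) 1 ∧ ∀ y ∈ Icc (0 : ℝ) 1, 0 ≤ p * (y - x) := by
    intro x p
    constructor
    · rintro ⟨h1, h2⟩
      have hx : x ∈ Icc (0 : ℝ) 1 := by
        by_contra hx
        exact h1 (by simp [indic01, hx])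
      refine ⟨hx, fun y hy => ?_⟩
      have h := h2 y
      simp only [indic01, if_pos hx, if_pos hy, zero_add] at h
      have h' : -p * (y - x) ≤ 0 := by exact_mod_cast h
      linarith
    · rintro ⟨hx, h⟩
      refine ⟨by simp only [indic01, if_pos hx]; exact EReal.zero_ne_top, fun y => ?_⟩
      by_cases hy : y ∈ Icc (0 : ℝ) 1
      · simp only [indic01, if_pos hx, if_pos hy, zero_add]
        have := h y hy
        have h' : -p * (y - x) ≤ 0 := by linarith
        exact_mod_cast h'
      · simp only [indic01, if_neg hy]
        exact le_top
  refine forall_congr' fun i => ?_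
  rw [key]
  generalize u i = x
  generalize α i = p
  refine and_congr_right fun hx => ?_
  constructor
  · intro h
    have h0 := h 0 (by simp)
    have h1 := h 1 (by simp)
    refine ⟨?_, ?_, ?_⟩
    · rintro rfl
      linarith
    · rintro ⟨ha, hb⟩
      apply le_antisymm <;> nlinarith
    · rintro rfl
      linarith
  · rintro ⟨h0, hm, h1⟩ y hy
    rcases hx.1.eq_or_lt with hx0 | hx0
    · have := h0 hx0.symm
      exact mul_nonneg this (by linarith [hy.1])
    rcases hx.2.eq_or_lt with hx1 | hx1
    · have := h1 hx1
      exact mul_nonneg_of_nonpos_of_nonpos this (by linarith [hy.2])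
    · simp [hm ⟨hx0, hx1⟩]

/-! ### Sobolev regularity in time and the Allen-Cahn equation

Functions of time are total functions on the line; only their values on the time interval `T`
matter. -/

/-- `u ∈ L²((a,b))`, for a function with values in the finite-dimensional space `V → ℝ`. -/
def MemL2 {V : Type*} (a b : ℝ) (u : ℝ → V → ℝ) : Prop :=
  ∀ i, MemLp (fun t => u t i) 2 (volume.restrict (Ioo a b))

/-- `v` is a weak derivative of `u` on `(a,b)`, tested against all smooth functions
`φ : (a,b) → (V → ℝ)` with compact support in `(a,b)`. -/
def IsWeakDeriv {V : Type*} [Fintype V] (G : WeightedGraph V) (r a b : ℝ)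
    (u v : ℝ → V → ℝ) : Prop :=
  ∀ φ : ℝ → V → ℝ, ContDiff ℝ ∞ φ → HasCompactSupport φ → tsupport φ ⊆ Ioo a b →
    ∫ t in Ioo a b, vInner G r (u t) (deriv φ t) = -∫ t in Ioo a b, vInner G r (v t) (φ t)

/-- `u` belongs to `H¹_loc(T)`, i.e. to `H¹((a,b))` for all `a, b ∈ T`, with weak derivative
`v`. -/
def HasH1locDeriv {V : Type*} [Fintype V] (G : WeightedGraph V) (r : ℝ) (T : Set ℝ)
    (u v : ℝ → V → ℝ) : Prop :=
  ∀ a ∈ T, ∀ b ∈ T, MemL2 a b u ∧ MemL2 a b v ∧ IsWeakDeriv G r a b u v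

/-- `(u, β)` is a solution on `T` of the double-obstacle Allen-Cahn equation with fidelity
forcing, for the parameter `μ` and the reference `f'` (so that `f = M f'`): `u` is continuous, in
`H¹_loc(T)`, with values in `[0,1]`, and for almost every `t ∈ T`
`ε u'(t) + ε A u(t) - ε f + 1/2 - u(t) = β(t) ∈ 𝓑(u(t))`, with `u'` the weak derivative. -/
def IsACESolution {V : Type*} [Fintype V] (G : WeightedGraph V) (r ε : ℝ) (μ f' : V → ℝ)
    (T : Set ℝ) (u β : ℝ → V → ℝ) : Prop :=
  (∀ t ∈ T, u t ∈ vertexFun V (Icc 0 1)) ∧ ContinuousOn u T ∧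
    ∃ u' : ℝ → V → ℝ, HasH1locDeriv G r T u u' ∧
      ∀ᵐ t ∂(volume.restrict T),
        ε • u' t + ε • opA G r μ (u t) - ε • fidOp μ f' + (fun _ => (1 / 2 : ℝ)) - u t = β t ∧
          β t ∈ obstacleB (u t)

end

end GraphACE

/-! The equation is the gradient flow of the energy for the weighted inner product, up to the
obstacle force. On `[0,1]`-valued functions the energy is a polynomial whose gradient in that inner
product is `A u - f + (1/2 - u)/ε`; dividing the equation by `ε` turns this into `β/ε - u'`. The
force does no work: where `u i` touches `0` or `1` inside the time interval it has an extremum, so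
its derivative vanishes wherever it exists, and elsewhere `β i = 0`. Hence the energy has derivative
`-‖u'‖²` almost everywhere.

To integrate this, `u` must be absolutely continuous. The du Bois-Reymond lemma identifies `u` with
a primitive of its weak derivative (`eq_add_integral_of_weak_deriv`), and the energy along `u`
inherits absolute continuity. The drop over `[s,t]` is therefore exactly `∫ ‖u'‖²`, which by
Cauchy-Schwarz is at least `‖u s - u t‖² / (t - s)`. This is twice the claimed bound; monotonicity
and nonnegativity of the energy then give the Hölder estimate. -/

namespace GraphACE

open MeasureTheory Set

open scoped ContDiff

/-! ### Weak derivatives on an interval -/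

/-- A smooth function with compact support in `(a,b)` and zero integral is the derivative of a
smooth function with compact support in `(a,b)`. -/
theorem exists_contDiff_primitive {a b : ℝ} (k : ℝ → ℝ) (hk : ContDiff ℝ ∞ k)
    (hc : HasCompactSupport k) (hs : tsupport k ⊆ Ioo a b) (h0 : ∫ x, k x = 0) :
    ∃ ψ : ℝ → ℝ, ContDiff ℝ ∞ ψ ∧ HasCompactSupport ψ ∧ tsupport ψ ⊆ Ioo a b ∧ deriv ψ = k := by
  by_cases hne : (tsupport k).Nonempty
  swap
  · have : k = 0 := by
      rw [not_nonempty_iff_eq_empty, tsupport_eq_empty_iff] at hne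
      exact hne
    subst this
    exact ⟨0, contDiff_const, .zero, by simp [tsupport], by ext; simp⟩
  obtain ⟨c, hcK, hcl⟩ := hc.isCompact.exists_isLeast hne
  obtain ⟨d, hdK, hdl⟩ := hc.isCompact.exists_isGreatest hne
  have hac := (hs hcK).1
  have hdb := (hs hdK).2
  have hder : ∀ x, HasDerivAt (fun x => ∫ t in a..x, k t) (k x) x := fun x =>
    intervalIntegral.integral_hasDerivAt_right (hk.continuous.intervalIntegrable _ _)
      (hk.continuous.stronglyMeasurableAtFilter _ _) hk.continuous.continuousAt
  have hd : deriv (fun x => ∫ t in a..x, k t) = k := funext fun x => (hder x).deriv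
  -- Left of `c` the integrand vanishes; right of `d` the primitive is the full integral of `k`,
  -- which is zero.
  have hsup : Function.support (fun x => ∫ t in a..x, k t) ⊆ Icc c d := by
    intro x hx
    by_contra hx'
    apply hx
    rcases lt_or_ge x c with hxc | hxc
    · refine (intervalIntegral.integral_congr (g := fun _ => 0) fun y hy => ?_).trans (by simp)
      have hyc : y < c := lt_of_le_of_lt hy.2 (max_lt hac hxc)
      by_contra hne
      exact absurd (hcl (subset_tsupport k hne)) (not_le.mpr hyc)
    · have hdx : d < x := not_le.mp fun h => hx' ⟨hxc, h⟩
      change ∫ t in a..x, k t = 0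
      rw [intervalIntegral.integral_eq_integral_of_support_subset, h0]
      exact fun y hy => ⟨lt_of_lt_of_le hac (hcl (subset_tsupport k hy)),
        (hdl (subset_tsupport k hy)).trans hdx.le⟩
  have hts : tsupport (fun x => ∫ t in a..x, k t) ⊆ Icc c d :=
    closure_minimal hsup isClosed_Icc
  refine ⟨_, contDiff_infty_iff_deriv.mpr ⟨fun x => (hder x).differentiableAt, ?_⟩,
    HasCompactSupport.of_support_subset_isCompact isCompact_Icc hsup,
    hts.trans (Icc_subset_Ioo hac hdb), hd⟩
  rw [hd]
  exact hk

/-- The lemma of du Bois-Reymond: a continuous function with zero weak derivative is constant. -/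
theorem eq_of_integral_mul_deriv_eq_zero {a b : ℝ} (hab : a < b) {h : ℝ → ℝ}
    (hh : ContinuousOn h (Icc a b))
    (hw : ∀ ψ : ℝ → ℝ, ContDiff ℝ ∞ ψ → HasCompactSupport ψ → tsupport ψ ⊆ Ioo a b →
      ∫ t in Ioo a b, h t * deriv ψ t = 0) :
    ∀ x ∈ Icc a b, h x = h a := by
  set m := (a + b) / 2
  -- The outer radius is a quarter of the length, so the support around the midpoint stays inside
  -- `(a,b)`.
  let η₀ : ContDiffBump m := ⟨(b - a) / 8, (b - a) / 4, by linarith, by linarith⟩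
  set η : ℝ → ℝ := η₀.normed volume
  have hη : ContDiff ℝ ∞ η := η₀.contDiff_normed
  have hηc : HasCompactSupport η := η₀.hasCompactSupport_normed
  have hη1 : ∫ x, η x = 1 := η₀.integral_normed
  have hηs : tsupport η ⊆ Ioo a b := by
    rw [η₀.tsupport_normed_eq, Real.closedBall_eq_Icc]
    apply Icc_subset_Ioo <;> simp only [η₀, m] <;> linarith
  set c := ∫ t in Ioo a b, h t * η t
  have hI : ∀ g : ℝ → ℝ, Continuous g → IntegrableOn (fun t => h t * g t) (Ioo a b) :=
    fun g hg => ((hh.mul hg.continuousOn).integrableOn_Icc).mono_set Ioo_subset_Icc_self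
  have hae : ∀ᵐ x, x ∈ Ioo a b → h x - c = 0 := by
    refine isOpen_Ioo.ae_eq_zero_of_integral_contDiff_smul_eq_zero
      (((hh.sub continuousOn_const).mono Ioo_subset_Icc_self).locallyIntegrableOn
        measurableSet_Ioo) ?_
    intro g hg hgc hgs
    -- Subtracting `(∫ g) η` makes the integral zero, so the difference is the derivative of an
    -- admissible test function.
    obtain ⟨ψ, hψ, hψc, hψs, hψd⟩ := exists_contDiff_primitive (a := a) (b := b)
      (fun x => g x - (∫ y, g y) * η x)
      (hg.sub (contDiff_const.mul hη)) (hgc.sub hηc.mul_left)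
      ((tsupport_sub _ _).trans
        (union_subset hgs ((closure_mono (Function.support_mul_subset_right _ _)).trans hηs))) (by
        rw [integral_sub (hg.continuous.integrable_of_hasCompactSupport hgc)
          ((hη.continuous.integrable_of_hasCompactSupport hηc).const_mul _),
          integral_const_mul, hη1]
        ring)
    have h1 := hw ψ hψ hψc hψs
    have h2 : ∫ x, g x • (h x - c) = ∫ x in Ioo a b, g x • (h x - c) := by
      rw [setIntegral_eq_integral_of_forall_compl_eq_zero]
      intro x hx
      rw [image_eq_zero_of_notMem_tsupport fun hx' => hx (hgs hx'), zero_smul]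
    have h3 : ∫ x in Ioo a b, g x = ∫ x, g x :=
      setIntegral_eq_integral_of_forall_compl_eq_zero fun x hx =>
        image_eq_zero_of_notMem_tsupport fun hx' => hx (hgs hx')
    have h4 : ∫ x in Ioo a b, h x * deriv ψ x =
        (∫ x in Ioo a b, h x * g x) - (∫ y, g y) * c := by
      rw [hψd, ← integral_const_mul, ← integral_sub (hI g hg.continuous)
        ((hI η hη.continuous).const_mul _)]
      congr 1
      ext x
      ring
    have h5 : ∫ x in Ioo a b, g x • (h x - c) =
        (∫ x in Ioo a b, h x * g x) - (∫ x in Ioo a b, g x) * c := by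
      rw [← integral_mul_const, ← integral_sub (hI g hg.continuous)
        ((hg.continuous.integrable_of_hasCompactSupport hgc).integrableOn.mul_const _)]
      congr 1
      ext x
      simp only [smul_eq_mul]
      ring
    rw [h2, h5, h3, ← h4, h1]
  have hc : ∀ x ∈ Icc a b, h x = c := by
    have : EqOn h (fun _ => c) (Ioo a b) := by
      refine Measure.eqOn_open_of_ae_eq (μ := volume) ?_ isOpen_Ioo (hh.mono Ioo_subset_Icc_self)
        continuousOn_const
      rw [Filter.EventuallyEq, ae_restrict_iff' measurableSet_Ioo]
      filter_upwards [hae] with x hx hx'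
      linarith [hx hx']
    exact this.of_subset_closure hh continuousOn_const Ioo_subset_Icc_self
      (by rw [closure_Ioo hab.ne])
  intro x hx
  rw [hc x hx, hc a (left_mem_Icc.mpr hab.le)]

/-- A continuous function with integrable weak derivative `v` is a primitive of `v`. -/
theorem eq_add_integral_of_weak_deriv {a b : ℝ} (hab : a < b) {w v : ℝ → ℝ}
    (hwc : ContinuousOn w (Icc a b)) (hv : IntervalIntegrable v volume a b)
    (hw : ∀ ψ : ℝ → ℝ, ContDiff ℝ ∞ ψ → HasCompactSupport ψ → tsupport ψ ⊆ Ioo a b →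
      ∫ t in Ioo a b, w t * deriv ψ t = -∫ t in Ioo a b, v t * ψ t) :
    ∀ x ∈ Icc a b, w x = w a + ∫ t in a..x, v t := by
  set P : ℝ → ℝ := fun x => ∫ t in a..x, v t
  have hP : AbsolutelyContinuousOnInterval P a b :=
    hv.absolutelyContinuousOnInterval_intervalIntegral left_mem_uIcc
  have hPc : ContinuousOn P (Icc a b) := by simpa [uIcc_of_le hab.le] using hP.continuousOn
  have key := eq_of_integral_mul_deriv_eq_zero hab (h := fun x => w x - P x) (hwc.sub hPc) ?_
  · intro x hx
    have := key x hx
    simp only [P, intervalIntegral.integral_same] at this ⊢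
    linarith
  intro ψ hψ hψc hψs
  have hz : ∀ x ∉ Ioo a b, ψ x = 0 := fun x hx =>
    image_eq_zero_of_notMem_tsupport fun hx' => hx (hψs hx')
  have hψd : Continuous (deriv ψ) := hψ.continuous_deriv (by simp)
  have hψac : AbsolutelyContinuousOnInterval ψ a b :=
    (hψ.of_le (by simp)).contDiffOn.absolutelyContinuousOnInterval
  -- Integration by parts shows that `P` also has weak derivative `v`, so `w - P` has weak
  -- derivative zero.
  have h1 := hP.integral_mul_deriv_eq_deriv_mul hψac
  have h2 : ∫ x in a..b, deriv P x * ψ x = ∫ x in a..b, v x * ψ x := by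
    apply intervalIntegral.integral_congr_ae
    filter_upwards [hv.ae_hasDerivAt_integral] with x hx hx'
    rw [(hx (uIoc_subset_uIcc hx') a left_mem_uIcc).deriv]
  rw [hz a (by simp), hz b (by simp), h2] at h1
  simp only [intervalIntegral.integral_of_le hab.le, integral_Ioc_eq_integral_Ioo] at h1
  have hI : ∀ f : ℝ → ℝ, ContinuousOn f (Icc a b) →
      IntegrableOn (fun t => f t * deriv ψ t) (Ioo a b) :=
    fun f hf => ((hf.mul hψd.continuousOn).integrableOn_Icc).mono_set Ioo_subset_Icc_self
  simp only [sub_mul]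
  rw [integral_sub (hI w hwc) (hI P hPc), hw ψ hψ hψc hψs, h1]
  ring

/-! ### The energy and its first variation -/

theorem w_eq_zero_of_not_adj {V : Type*} (G : WeightedGraph V) {i j : V} (h : ¬ G.Adj i j) : G.w i j = 0 :=
  le_antisymm (not_lt.mp fun h' => h ((G.w_pos_iff i j).mp h')) (G.w_nonneg i j)

section Energy

variable {V : Type*} [Fintype V] (G : WeightedGraph V)

theorem deg_nonneg (i : V) : 0 ≤ deg G i := Finset.sum_nonneg fun j _ => G.w_nonneg i j

theorem deg_rpow_nonneg (r : ℝ) (i : V) : 0 ≤ deg G i ^ r := Real.rpow_nonneg (deg_nonneg G i) r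

theorem eInner_grad_self (u : V → ℝ) :
    eInner G (grad G u) (grad G u) = 1 / 2 * ∑ i, ∑ j, (u j - u i) ^ 2 * G.w i j := by
  unfold eInner grad
  congr 1
  refine Finset.sum_congr rfl fun i _ => Finset.sum_congr rfl fun j _ => ?_
  by_cases h : G.Adj i j
  · simp [h, sq]
  · simp [w_eq_zero_of_not_adj G h]

/-- The Ginzburg-Landau energy on `[0,1]`-valued functions, as a polynomial. -/
noncomputable def energyReal (r ε : ℝ) (μ f' u : V → ℝ) : ℝ :=
  1 / 2 * (1 / 2 * ∑ i, ∑ j, (u j - u i) ^ 2 * G.w i j)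
    + 1 / ε * ∑ i, 1 / 2 * u i * (1 - u i) * deg G i ^ r
    + 1 / 2 * ∑ i, (u i - f' i) * (μ i * (u i - f' i)) * deg G i ^ r

theorem energyReal_nonneg {r ε : ℝ} (hε : 0 < ε) {μ : V → ℝ} (hμ : μ ∈ vertexFun V (Ici 0))
    (f' : V → ℝ) {u : V → ℝ} (hu : u ∈ vertexFun V (Icc 0 1)) :
    0 ≤ energyReal G r ε μ f' u := by
  have h1 : 0 ≤ ∑ i, ∑ j, (u j - u i) ^ 2 * G.w i j :=
    Finset.sum_nonneg fun i _ => Finset.sum_nonneg fun j _ =>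
      mul_nonneg (sq_nonneg _) (G.w_nonneg i j)
  have h2 : 0 ≤ ∑ i, 1 / 2 * u i * (1 - u i) * deg G i ^ r :=
    Finset.sum_nonneg fun i _ => mul_nonneg
      (mul_nonneg (mul_nonneg (by norm_num) (hu i).1) (sub_nonneg.mpr (hu i).2))
      (deg_rpow_nonneg G r i)
  have h3 : 0 ≤ ∑ i, (u i - f' i) * (μ i * (u i - f' i)) * deg G i ^ r :=
    Finset.sum_nonneg fun i _ => mul_nonneg
      (by rw [mul_left_comm]; exact mul_nonneg (hμ i) (mul_self_nonneg _))
      (deg_rpow_nonneg G r i)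
  unfold energyReal
  positivity

theorem ereal_coe_sum {ι : Type*} (s : Finset ι) (f : ι → ℝ) :
    ((∑ i ∈ s, f i : ℝ) : EReal) = ∑ i ∈ s, (f i : EReal) := by
  classical
  induction s using Finset.induction_on with
  | empty => simp
  | insert a s ha ih => rw [Finset.sum_insert ha, Finset.sum_insert ha, EReal.coe_add, ih]

/-- The infinite branch of the potential is never met on the box, so all estimates can be made in
`ℝ`. -/
theorem energyFid_eq_coe (r ε : ℝ) (μ f' : V → ℝ) {u : V → ℝ} (hu : u ∈ vertexFun V (Icc 0 1)) :
    energyFid G r ε μ f' u = (energyReal G r ε μ f' u : EReal) := by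
  have h : ∑ i, obstacleW (u i) * ((deg G i ^ r : ℝ) : EReal) =
      ((∑ i, 1 / 2 * u i * (1 - u i) * deg G i ^ r : ℝ) : EReal) := by
    rw [ereal_coe_sum]
    refine Finset.sum_congr rfl fun i _ => ?_
    rw [obstacleW, if_pos (hu i), ← EReal.coe_mul]
  rw [energyFid, h, eInner_grad_self, ← EReal.coe_mul, ← EReal.coe_add, ← EReal.coe_add]
  rfl

/-- The first variation of the Dirichlet energy (a discrete Green formula). -/
theorem sum_sum_sub_mul_sub (x v : V → ℝ) :
    ∑ i, ∑ j, (x j - x i) * (v j - v i) * G.w i j =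
      2 * ∑ i, v i * ∑ j, G.w i j * (x i - x j) := by
  -- Swapping the two vertices and using the symmetry of `w` makes both halves of the sum equal.
  have h1 : ∑ i, ∑ j, (x j - x i) * v j * G.w i j = ∑ i, ∑ j, v i * (G.w i j * (x i - x j)) := by
    rw [Finset.sum_comm]
    refine Finset.sum_congr rfl fun i _ => Finset.sum_congr rfl fun j _ => ?_
    rw [G.w_symm j i]
    ring
  have h2 : ∑ i, ∑ j, (x j - x i) * (v j - v i) * G.w i j =
      ∑ i, ∑ j, (x j - x i) * v j * G.w i j + ∑ i, ∑ j, v i * (G.w i j * (x i - x j)) := by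
    simp only [← Finset.sum_add_distrib]
    refine Finset.sum_congr rfl fun i _ => Finset.sum_congr rfl fun j _ => ?_
    ring
  rw [h2, h1, ← two_mul]
  simp only [Finset.mul_sum]

/-- Positivity of the vertex weights lets `d ^ (-r)` in the Laplacian cancel against `d ^ r` in the
inner product. -/
theorem hasDerivAt_energyReal (r ε : ℝ) (μ f' : V → ℝ) (hd : ∀ i, 0 < deg G i ^ r)
    {U : ℝ → V → ℝ} {v : V → ℝ} {τ : ℝ} (hU : ∀ i, HasDerivAt (fun t => U t i) (v i) τ) :
    HasDerivAt (fun t => energyReal G r ε μ f' (U t))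
      (∑ i, (opA G r μ (U τ) i - fidOp μ f' i + 1 / ε * (1 / 2 - U τ i)) * v i * deg G i ^ r)
      τ := by
  have h1 : HasDerivAt (fun t => ∑ i, ∑ j, (U t j - U t i) ^ 2 * G.w i j)
      (∑ i, ∑ j, 2 * ((U τ j - U τ i) * (v j - v i) * G.w i j)) τ := by
    refine HasDerivAt.fun_sum fun i _ => HasDerivAt.fun_sum fun j _ => ?_
    refine ((((hU j).sub (hU i)).fun_pow 2).mul_const (G.w i j)).congr_deriv ?_
    simp only [Pi.sub_apply]
    ring
  have h2 : HasDerivAt (fun t => ∑ i, 1 / 2 * U t i * (1 - U t i) * deg G i ^ r)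
      (∑ i, (1 / 2 - U τ i) * v i * deg G i ^ r) τ := by
    refine HasDerivAt.fun_sum fun i _ => ?_
    refine ((((hU i).const_mul (1 / 2)).mul ((hU i).const_sub 1)).mul_const _).congr_deriv ?_
    ring
  have h3 : HasDerivAt (fun t => ∑ i, (U t i - f' i) * (μ i * (U t i - f' i)) * deg G i ^ r)
      (∑ i, 2 * (μ i * (U τ i - f' i) * v i * deg G i ^ r)) τ := by
    refine HasDerivAt.fun_sum fun i _ => ?_
    refine ((((hU i).sub_const (f' i)).mul
      (((hU i).sub_const (f' i)).const_mul (μ i))).mul_const _).congr_deriv ?_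
    ring
  refine ((((h1.const_mul (1 / 2)).const_mul (1 / 2)).add (h2.const_mul (1 / ε))).add
    (h3.const_mul (1 / 2))).congr_deriv ?_
  simp only [← Finset.mul_sum]
  rw [sum_sum_sub_mul_sub]
  have h4 : ∀ i, (opA G r μ (U τ) i - fidOp μ f' i + 1 / ε * (1 / 2 - U τ i)) * v i * deg G i ^ r =
      v i * (∑ j, G.w i j * (U τ i - U τ j)) + 1 / ε * ((1 / 2 - U τ i) * v i * deg G i ^ r) +
        μ i * (U τ i - f' i) * v i * deg G i ^ r := by
    intro i
    have hA : opA G r μ (U τ) i =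
      deg G i ^ (-r) * (∑ j, G.w i j * (U τ i - U τ j)) + μ i * U τ i := rfl
    have hF : fidOp μ f' i = μ i * f' i := rfl
    have hD : deg G i ^ (-r) * deg G i ^ r = 1 := by
      rw [Real.rpow_neg (deg_nonneg G i), inv_mul_cancel₀ (hd i).ne']
    rw [hA, hF]
    linear_combination (v i * ∑ j, G.w i j * (U τ i - U τ j)) * hD
  simp only [h4, Finset.sum_add_distrib, ← Finset.mul_sum]
  ring

theorem absolutelyContinuousOnInterval_const {a b : ℝ} (c : ℝ) :
    AbsolutelyContinuousOnInterval (fun _ : ℝ => c) a b :=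
  contDiffOn_const.absolutelyContinuousOnInterval

theorem absolutelyContinuousOnInterval_sum {ι : Type*} (s : Finset ι) {f : ι → ℝ → ℝ} {a b : ℝ}
    (h : ∀ i, AbsolutelyContinuousOnInterval (f i) a b) :
    AbsolutelyContinuousOnInterval (fun t => ∑ i ∈ s, f i t) a b := by
  classical
  induction s using Finset.induction_on with
  | empty => simpa using absolutelyContinuousOnInterval_const 0
  | insert i s hi ih => simpa only [Finset.sum_insert hi] using (h i).fun_add ih

/-- The energy is polynomial in the components. Absolute continuity is what allows its increments to
be recovered from its almost everywhere derivative. -/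
theorem absolutelyContinuousOnInterval_energyReal (r ε : ℝ) (μ f' : V → ℝ) {U : ℝ → V → ℝ}
    {a b : ℝ} (hU : ∀ i, AbsolutelyContinuousOnInterval (fun t => U t i) a b) :
    AbsolutelyContinuousOnInterval (fun t => energyReal G r ε μ f' (U t)) a b := by
  have hc := fun c : ℝ => absolutelyContinuousOnInterval_const (a := a) (b := b) c
  unfold energyReal
  refine (((((absolutelyContinuousOnInterval_sum _ fun i =>
    absolutelyContinuousOnInterval_sum _ fun j => ?_).const_mul _).const_mul _).fun_add
    ((absolutelyContinuousOnInterval_sum _ fun i => ?_).const_mul _))).fun_add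
    ((absolutelyContinuousOnInterval_sum _ fun i => ?_).const_mul _)
  · simp only [sq]
    exact (((hU j).fun_sub (hU i)).fun_mul ((hU j).fun_sub (hU i))).fun_mul (hc _)
  · exact (((hU i).const_mul _).fun_mul ((hc 1).fun_sub (hU i))).fun_mul (hc _)
  · exact (((hU i).fun_sub (hc _)).fun_mul (((hU i).fun_sub (hc _)).const_mul _)).fun_mul (hc _)

end Energy

/-! ### Energy dissipation -/

/-- The Cauchy-Schwarz inequality for the increment of a primitive. -/
theorem sq_integral_le_mul_integral_sq {a b : ℝ} (hab : a < b) {v : ℝ → ℝ}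
    (hv : IntervalIntegrable v volume a b)
    (hv2 : IntervalIntegrable (fun t => v t ^ 2) volume a b) :
    (∫ t in a..b, v t) ^ 2 ≤ (b - a) * ∫ t in a..b, v t ^ 2 := by
  set I := ∫ t in a..b, v t
  have hba : 0 < b - a := sub_pos.mpr hab
  -- `c` is the mean of `v`; the claim is that its variance is nonnegative.
  set c := I / (b - a)
  have hc : c * (b - a) = I := div_mul_cancel₀ _ hba.ne'
  have h0 : 0 ≤ ∫ t in a..b, (v t - c) ^ 2 :=
    intervalIntegral.integral_nonneg hab.le fun t _ => sq_nonneg _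
  have h1 : ∫ t in a..b, (v t - c) ^ 2 = (∫ t in a..b, v t ^ 2) - 2 * c * I + c ^ 2 * (b - a) := by
    have : ∀ t, (v t - c) ^ 2 = v t ^ 2 - 2 * c * v t + c ^ 2 := fun t => by ring
    simp only [this]
    rw [intervalIntegral.integral_add (hv2.sub (hv.const_mul _)) intervalIntegrable_const,
      intervalIntegral.integral_sub hv2 (hv.const_mul _), intervalIntegral.integral_const_mul,
      intervalIntegral.integral_const, smul_eq_mul]
    ring
  nlinarith [mul_nonneg hba.le (h1 ▸ h0)]

/-- A differentiable function with values in `[0,1]` has zero derivative where it takes the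
values `0` or `1`, so its derivative annihilates every element of the obstacle set. -/
theorem obstacle_mul_deriv_eq_zero {V : Type*} {x β : V → ℝ} (hβ : β ∈ obstacleB x) (i : V)
    {y : ℝ → ℝ} {y' τ : ℝ} (hy : HasDerivAt y y' τ) (hyx : y τ = x i)
    (hbox : ∀ᶠ t in nhds τ, y t ∈ Icc (0 : ℝ) 1) : β i * y' = 0 := by
  obtain ⟨hx, h0, hm, h1⟩ := (mem_obstacleB_iff x β).mp hβ i
  rcases hx.1.eq_or_lt with hx0 | hx0
  · have : IsLocalMin y τ := by
      filter_upwards [hbox] with t ht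
      rw [hyx, ← hx0]
      exact ht.1
    rw [this.hasDerivAt_eq_zero hy, mul_zero]
  rcases hx.2.eq_or_lt with hx1 | hx1
  · have : IsLocalMax y τ := by
      filter_upwards [hbox] with t ht
      rw [hyx, hx1]
      exact ht.2
    rw [this.hasDerivAt_eq_zero hy, mul_zero]
  · rw [hm ⟨hx0, hx1⟩, zero_mul]

theorem vNorm_sq {V : Type*} [Fintype V] (G : WeightedGraph V) (r : ℝ) (u : V → ℝ) :
    vNorm G r u ^ 2 = ∑ i, u i ^ 2 * deg G i ^ r := by
  have h : vInner G r u u = ∑ i, u i ^ 2 * deg G i ^ r := by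
    simp only [vInner, sq]
  rw [vNorm, Real.sq_sqrt, h]
  rw [h]
  exact Finset.sum_nonneg fun i _ => mul_nonneg (sq_nonneg _) (deg_rpow_nonneg G r i)

/-- The components of a function with a weak derivative in `L²` are primitives of the
components of the weak derivative. -/
theorem eq_add_integral_of_isWeakDeriv {V : Type*} [Fintype V] (G : WeightedGraph V) {r s t : ℝ}
    (hst : s < t) {u v : ℝ → V → ℝ} (huc : ContinuousOn u (Icc s t))
    (hw : IsWeakDeriv G r s t u v) (i : V) (hd : deg G i ^ r ≠ 0)
    (hv : IntervalIntegrable (fun τ => v τ i) volume s t) :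
    ∀ x ∈ Icc s t, u x i = u s i + ∫ τ in s..x, v τ i := by
  classical
  refine eq_add_integral_of_weak_deriv hst (continuousOn_pi.mp huc i) hv ?_
  intro ψ hψ hψc hψs
  -- Testing with `ψ` times the `i`-th unit vector isolates component `i`, up to the nonzero factor
  -- `d i ^ r`.
  have hder : ∀ τ, deriv (fun τ => ψ τ • (Pi.single i 1 : V → ℝ)) τ =
      deriv ψ τ • (Pi.single i 1 : V → ℝ) := fun τ =>
    deriv_smul_const ((hψ.differentiable (by simp)) τ) _
  have hin : ∀ (x : V → ℝ) (c : ℝ),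
      vInner G r x (c • (Pi.single i 1 : V → ℝ)) = x i * c * deg G i ^ r := by
    intro x c
    rw [vInner, Finset.sum_eq_single i]
    · simp
    · intro j _ hj
      simp [hj]
    · simp
  have h := hw (fun τ => ψ τ • (Pi.single i 1 : V → ℝ)) (hψ.smul contDiff_const)
    hψc.smul_right ((tsupport_smul_subset_left _ _).trans hψs)
  simp only [hder, hin, integral_mul_const] at h
  rw [← neg_mul] at h
  exact mul_right_cancel₀ hd h

/-- The energy of a solution drops by at least the mean squared velocity. -/
theorem energyReal_dissipation {V : Type*} [Fintype V] (G : WeightedGraph V) {r ε : ℝ}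
    (hε : 0 < ε) {μ f' : V → ℝ} (hd : ∀ i, 0 < deg G i ^ r) {T : Set ℝ} {u β : ℝ → V → ℝ}
    (hu : IsACESolution G r ε μ f' T u β) {s t : ℝ} (hs : s ∈ T) (ht : t ∈ T) (hst : s < t)
    (hsub : Icc s t ⊆ T) :
    1 / (t - s) * vNorm G r (u s - u t) ^ 2 ≤
      energyReal G r ε μ f' (u s) - energyReal G r ε μ f' (u t) := by
  obtain ⟨hbox, hcont, v, hH, hae⟩ := hu
  obtain ⟨-, hv, hw⟩ := hH s hs t ht
  have hv1 : ∀ i, IntervalIntegrable (fun τ => v τ i) volume s t := fun i => by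
    rw [intervalIntegrable_iff_integrableOn_Ioo_of_le hst.le]
    exact (hv i).integrable (by norm_num)
  have hv2 : ∀ i, IntervalIntegrable (fun τ => v τ i ^ 2) volume s t := fun i => by
    rw [intervalIntegrable_iff_integrableOn_Ioo_of_le hst.le]
    exact (hv i).integrable_sq
  have hprim := fun i => eq_add_integral_of_isWeakDeriv G hst (hcont.mono hsub) hw i
    (hd i).ne' (hv1 i)
  -- `U` agrees with `u` on `[s,t]`; as an explicit primitive it has derivative `v` almost
  -- everywhere there.
  set U : ℝ → V → ℝ := fun x i => u s i + ∫ τ in s..x, v τ i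
  have hUu : ∀ x ∈ Icc s t, U x = u x := fun x hx => funext fun i => (hprim i x hx).symm
  have hUac : ∀ i, AbsolutelyContinuousOnInterval (fun x => U x i) s t := fun i =>
    (absolutelyContinuousOnInterval_const _).fun_add
      ((hv1 i).absolutelyContinuousOnInterval_intervalIntegral left_mem_uIcc)
  have hE := (absolutelyContinuousOnInterval_energyReal G r ε μ f' hUac).integral_deriv_eq_sub
  have hder : ∫ τ in s..t, deriv (fun x => energyReal G r ε μ f' (U x)) τ =
      ∫ τ in s..t, -∑ i, v τ i ^ 2 * deg G i ^ r := by
    simp only [intervalIntegral.integral_of_le hst.le, integral_Ioc_eq_integral_Ioo]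
    apply setIntegral_congr_ae measurableSet_Ioo
    have h1 : ∀ᵐ τ, ∀ i, τ ∈ uIcc s t → ∀ c ∈ uIcc s t,
        HasDerivAt (fun x => ∫ y in c..x, v y i) (v τ i) τ :=
      ae_all_iff.mpr fun i => (hv1 i).ae_hasDerivAt_integral
    have h2 := (ae_restrict_iff' measurableSet_Ioo).mp
      (ae_restrict_of_ae_restrict_of_subset (Ioo_subset_Icc_self.trans hsub) hae)
    filter_upwards [h1, h2] with τ h1 h2 hτ
    have hτ' := Ioo_subset_Icc_self hτ
    obtain ⟨heq, hβ⟩ := h2 hτ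
    have hUd : ∀ i, HasDerivAt (fun x => U x i) (v τ i) τ := fun i =>
      (h1 i (by rwa [uIcc_of_le hst.le]) s left_mem_uIcc).const_add _
    rw [(hasDerivAt_energyReal G r ε μ f' hd hUd).deriv, ← Finset.sum_neg_distrib]
    refine Finset.sum_congr rfl fun i _ => ?_
    have hz : β τ i * v τ i = 0 := by
      refine obstacle_mul_deriv_eq_zero hβ i (hUd i) (by rw [hUu τ hτ']) ?_
      filter_upwards [isOpen_Ioo.mem_nhds hτ] with x hx
      rw [hUu x (Ioo_subset_Icc_self hx)]
      exact hbox x (hsub (Ioo_subset_Icc_self hx)) i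
    have hi := congrFun heq i
    simp only [Pi.sub_apply, Pi.add_apply, Pi.smul_apply, smul_eq_mul] at hi
    rw [hUu τ hτ', one_div]
    have hεi : ε⁻¹ * ε = 1 := inv_mul_cancel₀ hε.ne'
    -- The gradient is `β/ε - v`; paired with `v`, the `β` term drops out by `hz`.
    linear_combination (ε⁻¹ * v τ i * deg G i ^ r) * hi + (ε⁻¹ * deg G i ^ r) * hz
      - (v τ i + opA G r μ (u τ) i - fidOp μ f' i) * v τ i * deg G i ^ r * hεi
  have hdiss : energyReal G r ε μ f' (u s) - energyReal G r ε μ f' (u t) =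
      ∑ i, (∫ τ in s..t, v τ i ^ 2) * deg G i ^ r := by
    rw [hder, hUu t (right_mem_Icc.mpr hst.le), hUu s (left_mem_Icc.mpr hst.le),
      intervalIntegral.integral_neg,
      intervalIntegral.integral_finsetSum fun i _ => (hv2 i).mul_const _] at hE
    simp only [intervalIntegral.integral_mul_const] at hE
    linarith
  have hts : 0 < t - s := sub_pos.mpr hst
  rw [hdiss, vNorm_sq, one_div, inv_mul_le_iff₀ hts, Finset.mul_sum]
  refine Finset.sum_le_sum fun i _ => ?_
  rw [← mul_assoc]
  refine mul_le_mul_of_nonneg_right ?_ (hd i).le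
  have : (u s - u t) i ^ 2 = (∫ τ in s..t, v τ i) ^ 2 := by
    rw [Pi.sub_apply, hprim i t (right_mem_Icc.mpr hst.le)]
    ring
  rw [this]
  exact sq_integral_le_mul_integral_sq hst (hv1 i) (hv2 i)

/-! ### The degenerate one-vertex graph -/

/-- A vertex of zero degree in a connected graph is the only vertex. -/
theorem eq_of_deg_eq_zero {V : Type*} [Fintype V] (G : WeightedGraph V) {i : V}
    (hi : deg G i = 0) (j : V) : j = i := by
  by_contra hne
  have : Nontrivial V := ⟨j, i, hne⟩
  obtain ⟨k, hk⟩ := G.connected.preconnected.exists_adj_of_nontrivial i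
  have h1 := (G.w_pos_iff i k).mpr hk
  have h2 : G.w i k ≤ deg G i :=
    Finset.single_le_sum (f := fun k => G.w i k) (fun k _ => G.w_nonneg i k) (Finset.mem_univ k)
  linarith

/-- If the vertex measure vanishes somewhere, it vanishes everywhere, and so do the weights. -/
theorem weights_eq_zero_of_deg_rpow_eq_zero {V : Type*} [Fintype V] (G : WeightedGraph V) {r : ℝ}
    {i : V} (hi : deg G i ^ r = 0) : (∀ j, deg G j ^ r = 0) ∧ ∀ j k, G.w j k = 0 := by
  have hdeg := ((Real.rpow_eq_zero_iff_of_nonneg (deg_nonneg G i)).mp hi).1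
  have hall := eq_of_deg_eq_zero G hdeg
  refine ⟨fun j => by rw [hall j, hi], fun j k => ?_⟩
  rw [hall j, hall k]
  exact w_eq_zero_of_not_adj G (G.loopless.irrefl i)

/-- If the vertex measure vanishes, the weak derivative condition carries no information, but the
norm and the energy are then identically zero. -/
theorem vNorm_sq_le_energyReal_sub {V : Type*} [Fintype V] (G : WeightedGraph V) {r ε : ℝ}
    (hε : 0 < ε) {μ f' : V → ℝ} {T : Set ℝ} {u β : ℝ → V → ℝ}
    (hu : IsACESolution G r ε μ f' T u β) {s t : ℝ} (hs : s ∈ T) (ht : t ∈ T) (hst : s < t)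
    (hsub : Icc s t ⊆ T) :
    1 / (t - s) * vNorm G r (u s - u t) ^ 2 ≤
      energyReal G r ε μ f' (u s) - energyReal G r ε μ f' (u t) := by
  by_cases hd : ∀ i, 0 < deg G i ^ r
  · exact energyReal_dissipation G hε hd hu hs ht hst hsub
  · push Not at hd
    obtain ⟨i, hi⟩ := hd
    obtain ⟨h1, h2⟩ :=
      weights_eq_zero_of_deg_rpow_eq_zero G (le_antisymm hi (deg_rpow_nonneg G r i))
    simp [vNorm_sq, energyReal, h1, h2]

theorem vNorm_sub_comm {V : Type*} [Fintype V] (G : WeightedGraph V) (r : ℝ) (x y : V → ℝ) :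
    vNorm G r (x - y) = vNorm G r (y - x) := by
  unfold vNorm vInner
  congr 1
  refine Finset.sum_congr rfl fun i _ => ?_
  simp only [Pi.sub_apply]
  ring

end GraphACE

/-! ### Monotonicity and the Hölder bound -/

theorem theorem2p15 {V : Type*} [Fintype V] (G : GraphACE.WeightedGraph V)
    (r : ℝ) (hr : r ∈ Set.Icc (0 : ℝ) 1) (ε : ℝ) (hε : 0 < ε)
    (μ : V → ℝ) (hμ : μ ∈ GraphACE.vertexFun V (Set.Ici 0)) (hμ0 : μ ≠ 0)
    (f' : V → ℝ) (hf' : f' ∈ GraphACE.vertexFun V (Set.Icc 0 1))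
    (hσ : ε⁻¹ ∉ GraphACE.eigenvalueSet (GraphACE.opA G r μ))
    (T : Set ℝ) (hT : T = Set.Ici 0 ∨ ∃ T₀ : ℝ, 0 < T₀ ∧ T = Set.Icc 0 T₀)
    (u β : ℝ → V → ℝ) (hu : GraphACE.IsACESolution G r ε μ f' T u β) :
    (∀ t ∈ T, GraphACE.energyFid G r ε μ f' (u t) ≠ ⊤ ∧
      GraphACE.energyFid G r ε μ f' (u t) ≠ ⊥) ∧
    AntitoneOn (fun t => GraphACE.energyFid G r ε μ f' (u t)) T ∧
    (∀ s ∈ T, ∀ t ∈ T, s < t →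
      GraphACE.energyFid G r ε μ f' (u s) - GraphACE.energyFid G r ε μ f' (u t) ≥
        ((1 / (2 * (t - s)) * GraphACE.vNorm G r (u s - u t) ^ 2 : ℝ) : EReal)) ∧
    (∀ s ∈ T, ∀ t ∈ T,
      GraphACE.vNorm G r (u s - u t) ≤
        Real.sqrt |t - s| *
          Real.sqrt (2 * (GraphACE.energyFid G r ε μ f' (u 0)).toReal)) := by
  have hsub : ∀ s ∈ T, ∀ t ∈ T, Set.Icc s t ⊆ T := by
    rcases hT with rfl | ⟨T₀, -, rfl⟩
    · exact fun s hs t _ x hx => le_trans hs hx.1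
    · exact fun s hs t ht x hx => ⟨hs.1.trans hx.1, hx.2.trans ht.2⟩
  have hT0 : (0 : ℝ) ∈ T ∧ ∀ t ∈ T, 0 ≤ t := by
    rcases hT with rfl | ⟨T₀, hT₀, rfl⟩
    · exact ⟨le_refl (0 : ℝ), fun t ht => ht⟩
    · exact ⟨⟨le_rfl, hT₀.le⟩, fun t ht => ht.1⟩
  have hcoe : ∀ t ∈ T, GraphACE.energyFid G r ε μ f' (u t) =
      (GraphACE.energyReal G r ε μ f' (u t) : EReal) := fun t ht =>
    GraphACE.energyFid_eq_coe G r ε μ f' (hu.1 t ht)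
  have hdrop : ∀ s ∈ T, ∀ t ∈ T, s < t →
      1 / (t - s) * GraphACE.vNorm G r (u s - u t) ^ 2 ≤
        GraphACE.energyReal G r ε μ f' (u s) - GraphACE.energyReal G r ε μ f' (u t) :=
    fun s hs t ht hst =>
      GraphACE.vNorm_sq_le_energyReal_sub G hε hu hs ht hst (hsub s hs t ht)
  have hmono : ∀ s ∈ T, ∀ t ∈ T, s ≤ t →
      GraphACE.energyReal G r ε μ f' (u t) ≤ GraphACE.energyReal G r ε μ f' (u s) := by
    intro s hs t ht hst
    rcases hst.eq_or_lt with rfl | hst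
    · exact le_rfl
    · have h1 : 0 < t - s := sub_pos.mpr hst
      have h2 : 0 ≤ 1 / (t - s) * GraphACE.vNorm G r (u s - u t) ^ 2 := by positivity
      linarith [hdrop s hs t ht hst]
  have hnonneg : ∀ t ∈ T, 0 ≤ GraphACE.energyReal G r ε μ f' (u t) := fun t ht =>
    GraphACE.energyReal_nonneg G hε hμ f' (hu.1 t ht)
  have hhold : ∀ s ∈ T, ∀ t ∈ T, s < t →
      GraphACE.vNorm G r (u s - u t) ≤ Real.sqrt |t - s| *
        Real.sqrt (2 * (GraphACE.energyFid G r ε μ f' (u 0)).toReal) := by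
    intro s hs t ht hst
    have h1 : 0 < t - s := sub_pos.mpr hst
    rw [hcoe 0 hT0.1, EReal.toReal_coe, abs_of_pos h1, ← Real.sqrt_mul h1.le]
    apply Real.le_sqrt_of_sq_le
    have h2 := hdrop s hs t ht hst
    rw [one_div, inv_mul_le_iff₀ h1] at h2
    refine h2.trans (mul_le_mul_of_nonneg_left ?_ h1.le)
    -- The drop is at most the energy at time `0`; the factor `2` is slack.
    linarith [hmono 0 hT0.1 s hs (hT0.2 s hs), hnonneg t ht, hnonneg 0 hT0.1]
  refine ⟨fun t ht => ?_, fun s hs t ht hst => ?_, fun s hs t ht hst => ?_, fun s hs t ht => ?_⟩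
  · rw [hcoe t ht]
    exact ⟨EReal.coe_ne_top _, EReal.coe_ne_bot _⟩
  · simp only [hcoe s hs, hcoe t ht]
    exact_mod_cast hmono s hs t ht hst
  · rw [hcoe s hs, hcoe t ht, ← EReal.coe_sub, ge_iff_le, EReal.coe_le_coe_iff]
    -- `hdrop` has the constant `1 / (t - s)`, twice what is needed.
    refine le_trans ?_ (hdrop s hs t ht hst)
    have h1 : 0 < t - s := sub_pos.mpr hst
    gcongr
    linarith
  · rcases lt_trichotomy s t with hst | rfl | hst
    · exact hhold s hs t ht hst
    · simp [GraphACE.vNorm, GraphACE.vInner]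
    · rw [GraphACE.vNorm_sub_comm, abs_sub_comm]
      exact hhold t ht s hs hst
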